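/- Fix integers $r \ge 2$ and $K \ge 1$. For each $n$, let $H_n = (V(H_n), E(H_n))$ be a finite $r$-uniform hypergraph (so $V(H_n)$ is a finite set and $E(H_n)$ is a set of $r$-element subsets of $V(H_n)$), in which every hyperedge $e \in E(H_n)$ carries an integer weight $w_{n,e} \in \{1, \dots, K\}$. Let $(c_n)$ be a sequence of numbers of colors with $c_n \to \infty$, and let the colors $X_v^{(n)}$, $v \in V(H_n)$, be independent and uniformly distributed on a set of $c_n$ colors. Let $$W(H_n) = \sum_{e \in E(H_n)} w_{n,e}\, \mathbf 1\{X_u^{(n)} = X_v^{(n)} \text{ for all } u, v \in e\}$$ be the weighted number of monochromatic hyperedges. If, for some $\lambda \ge 0$, $$\lim_{n\to\infty} \mathbb E\, W(H_n) = \lambda \quad\text{and}\quad \lim_{n\to\infty} \operatorname{Var} W(H_n) = \lambda,$$ then $W(H_n)$ converges in distribution, as $n \to \infty$, to the Poisson distribution $\mathrm{Pois}(\lambda)$ (where $\mathrm{Pois}(0)$ is the point mass at $0$). -/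

import Mathlib

open Filter Topology MeasureTheory ProbabilityTheory
open scoped NNReal Hypergraph

namespace MonoColoring

/-- A hypergraph is `r`-uniform if every hyperedge has exactly `r` vertices. -/
def IsUniformHypergraph {α : Type*} (H : Hypergraph α) (r : ℕ) : Prop :=
  ∀ e ∈ E(H), e.encard = r

/-- A hyperedge `e` is monochromatic under the vertex colouring `x` if all of its vertices have
the same colour. -/
def IsMonochromatic {α C : Type*} {H : Hypergraph α} (x : V(H) → C) (e : Set α) : Prop :=
  ∀ u v : V(H), (u : α) ∈ e → (v : α) ∈ e → x u = x v

open Classical in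
/-- The weighted number of monochromatic hyperedges of `H` under the vertex colouring `x`,
`∑ e ∈ E(H), w e * 1{e is monochromatic}`. (The sum is finite as soon as `V(H)` is finite.) -/
noncomputable def weightedMonoCount {α C : Type*} (H : Hypergraph α) (w : Set α → ℕ)
    (x : V(H) → C) : ℝ :=
  ∑ᶠ e ∈ E(H), (w e : ℝ) * (if IsMonochromatic x e then 1 else 0)

/-- The random colours `X v`, `v ∈ V`, are independent and each is uniformly distributed on the
`c` colours. -/
structure IsUniformColoring {V Ω : Type*} [MeasurableSpace Ω] {c : ℕ}
    (X : V → Ω → Fin c) (P : Measure Ω) : Prop where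
  indep : iIndepFun X P
  law : ∀ v, HasLaw (X v) (uniformOn (Set.univ : Set (Fin c))) P

end MonoColoring

/-! This is Stein–Chen size biasing, tested on `y ↦ exp(iθy)`. A given hyperedge is monochromatic
with probability `p = c^{-(r-1)}`, and conditioning on this amounts to giving `e` the colour of one
vertex `u ∈ e` (`expect_monoInd_smul`). Hence `𝔼 W g(W) = ∑ w_e p 𝔼 g(W after recolouring e)`.
Usually recolouring just adds 1 to `W` (`monoSum_recolor`), so this is close to `μ 𝔼 g(W + 1)`. For
exponentials that is the differential equation of the Poisson characteristic function, up to a small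
error, and an integrating factor finishes.

The exceptions are: `w_e ≥ 2`; `e` already monochromatic; or another `f` meeting `e \ {u}`
monochromatic before or after. Pairs sharing at most one vertex are uncorrelated, while those
sharing two or more ("heavy") are jointly monochromatic with probability at least `c p²`. So
variance minus mean, plus a term of order `p`, dominates the contributions of large weights and
heavy pairs (`rare_events_le_variance_sub_mean`).

The remaining pairs cost `p²` each and must be counted. Taking `u` of largest degree in `e` and
applying Cauchy–Schwarz over pairs of vertices bounds their number by a multiple of `m √(m +
#heavy)`, where `m` is the number of hyperedges (`sum_sum_vertexDegree_erase_le`). Since `pm` is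
bounded, `p²` times this tends to 0. -/

open scoped BigOperators

namespace MonoColoring

/-! ### Recolouring as conditioning; joint probabilities of two hyperedges. -/

section Recolor

open Finset

variable {V : Type*} {c : ℕ}

/-- The vertices in `e` all have the same colour under `x`. -/
def IsConstOn (x : V → Fin c) (e : Finset V) : Prop := ∀ u ∈ e, ∀ v ∈ e, x u = x v

instance (x : V → Fin c) (e : Finset V) : Decidable (IsConstOn x e) := by
  unfold IsConstOn; infer_instance

/-- The indicator that `e` is monochromatic under `x`. -/
def monoInd (x : V → Fin c) (e : Finset V) : ℝ := if IsConstOn x e then 1 else 0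

lemma monoInd_nonneg (x : V → Fin c) (e : Finset V) : 0 ≤ monoInd x e := by
  unfold monoInd; split_ifs <;> norm_num

lemma monoInd_mul_self (x : V → Fin c) (e : Finset V) :
    monoInd x e * monoInd x e = monoInd x e := by
  unfold monoInd; split_ifs <;> norm_num

lemma monoInd_congr {x y : V → Fin c} {e : Finset V} (h : ∀ v ∈ e, x v = y v) :
    monoInd x e = monoInd y e := by
  have : IsConstOn x e ↔ IsConstOn y e := by
    constructor
    · intro H u hu v hv; rw [← h u hu, ← h v hv]; exact H u hu v hv
    · intro H u hu v hv; rw [h u hu, h v hv]; exact H u hu v hv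
  simp [monoInd, this]

variable [DecidableEq V]

/-- Give all the vertices of `e` the colour of `u`. -/
def recolor (e : Finset V) (u : V) (x : V → Fin c) : V → Fin c :=
  fun v => if v ∈ e then x u else x v

lemma isConstOn_recolor (e : Finset V) (u : V) (x : V → Fin c) : IsConstOn (recolor e u x) e := by
  intro a ha b hb; simp [recolor, ha, hb]

lemma monoInd_recolor (e : Finset V) (u : V) (x : V → Fin c) : monoInd (recolor e u x) e = 1 := by
  simp [monoInd, isConstOn_recolor]

lemma recolor_of_notMem_erase {e : Finset V} {u v : V} (x : V → Fin c) (hv : v ∉ e.erase u) :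
    recolor e u x v = x v := by
  unfold recolor
  split_ifs with h
  · have : v = u := by by_contra hne; exact hv (mem_erase.2 ⟨hne, h⟩)
    rw [this]
  · rfl

variable [Fintype V]

/-- The colours on `e \ {u}` are forgotten and all others kept, so every colouring in the image has
`c ^ (#e - 1)` preimages. -/
lemma card_filter_recolor_eq {e : Finset V} {u : V} (hu : u ∈ e) (y : V → Fin c) :
    (#{x | recolor e u x = y} : ℝ) = (c : ℝ) ^ (#e - 1) * monoInd y e := by
  unfold monoInd
  split_ifs with hy
  · have : ({x | recolor e u x = y} : Finset (V → Fin c)) =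
        Fintype.piFinset fun v => if v ∈ e.erase u then univ else {y v} := by
      ext x
      simp only [mem_filter, mem_univ, true_and, Fintype.mem_piFinset]
      constructor
      · rintro rfl v
        split_ifs with h
        · simp
        · simp [recolor_of_notMem_erase x h]
      · intro h
        funext v
        have hxu : x u = y u := by simpa using h u
        unfold recolor
        split_ifs with hv
        · rw [hxu]; exact hy u hu v hv
        · have := h v
          simpa [hv] using this
    rw [this, Fintype.card_piFinset]
    simp only [apply_ite card, card_univ, Fintype.card_fin, card_singleton, prod_ite, prod_const,
      mul_one, one_pow]
    rw [filter_mem_eq_inter, univ_inter, card_erase_of_mem hu]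
    push_cast; ring
  · rw [mul_zero, Nat.cast_eq_zero, card_eq_zero, filter_eq_empty_iff]
    rintro x - rfl
    exact hy (isConstOn_recolor _ _ _)

/-- Conditioning on `e` being monochromatic is the same as recolouring `e`. -/
lemma expect_monoInd_smul {M : Type*} [AddCommGroup M] [Module ℝ M] [Module ℚ≥0 M]
    [SMulCommClass ℝ ℚ≥0 M] (hc : c ≠ 0)
    {e : Finset V} {u : V} (hu : u ∈ e) (h : (V → Fin c) → M) :
    𝔼 x, monoInd x e • h x = ((c : ℝ)⁻¹ ^ (#e - 1)) • 𝔼 x, h (recolor e u x) := by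
  have hc' : (c : ℝ) ≠ 0 := by exact_mod_cast hc
  have key : ∑ x, h (recolor e u x) = (c : ℝ) ^ (#e - 1) • ∑ x, monoInd x e • h x := by
    rw [← sum_fiberwise univ (recolor e u) fun x => h (recolor e u x), smul_sum]
    refine sum_congr rfl fun y _ => ?_
    rw [sum_congr rfl (g := fun _ => h y) fun x hx => by rw [(mem_filter.1 hx).2], sum_const,
      ← Nat.cast_smul_eq_nsmul ℝ, card_filter_recolor_eq hu, mul_smul]
  unfold Finset.expect
  rw [key, smul_comm (_ : ℚ≥0) (_ : ℝ), smul_smul, inv_pow, inv_mul_cancel₀ (pow_ne_zero _ hc'),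
    one_smul]

lemma expect_monoInd_mul (hc : c ≠ 0) {e : Finset V} {u : V} (hu : u ∈ e)
    (h : (V → Fin c) → ℝ) :
    𝔼 x, monoInd x e * h x = (c : ℝ)⁻¹ ^ (#e - 1) * 𝔼 x, h (recolor e u x) :=
  expect_monoInd_smul hc hu h

lemma expect_monoInd (hc : c ≠ 0) {e : Finset V} (he : e.Nonempty) :
    𝔼 x : V → Fin c, monoInd x e = (c : ℝ)⁻¹ ^ (#e - 1) := by
  obtain ⟨u, hu⟩ := he
  have : NeZero c := ⟨hc⟩
  have := expect_monoInd_mul hc hu fun _ => 1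
  simpa using this

/-- Indicators of hyperedges that share at most one vertex are uncorrelated. -/
lemma expect_monoInd_mul_monoInd_of_card_inter_le (hc : c ≠ 0) {e f : Finset V} (he : e.Nonempty)
    (hf : f.Nonempty) (hef : #(e ∩ f) ≤ 1) :
    𝔼 x : V → Fin c, monoInd x e * monoInd x f =
      (c : ℝ)⁻¹ ^ (#e - 1) * (c : ℝ)⁻¹ ^ (#f - 1) := by
  -- With `u` the only possible common vertex, recolouring `e` leaves `f` untouched.
  obtain ⟨u, hu, hsub⟩ : ∃ u ∈ e, ∀ v ∈ e ∩ f, v = u := by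
    rcases (e ∩ f).eq_empty_or_nonempty with h | ⟨u, hu⟩
    · obtain ⟨u, hu⟩ := he
      exact ⟨u, hu, by simp [h]⟩
    · exact ⟨u, (mem_inter.1 hu).1, fun v hv => card_le_one.1 hef v hv u hu⟩
  rw [expect_monoInd_mul hc hu, ← expect_monoInd hc hf]
  congr 1
  refine expect_congr rfl fun x _ => monoInd_congr fun v hv => recolor_of_notMem_erase x fun h => ?_
  rw [mem_erase] at h
  exact h.1 (hsub v (mem_inter.2 ⟨h.2, hv⟩))

/-- Indicators of hyperedges that share at least two vertices are strongly correlated. -/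
lemma le_expect_monoInd_mul_monoInd (hc : c ≠ 0) {e f : Finset V} (hef : 2 ≤ #(e ∩ f)) :
    (c : ℝ)⁻¹ ^ (#e - 1) * (c : ℝ)⁻¹ ^ (#f - 2) ≤
      𝔼 x : V → Fin c, monoInd x e * monoInd x f := by
  obtain ⟨u, hu, v, hv, huv⟩ := one_lt_card.1 (show 1 < #(e ∩ f) by omega)
  rw [mem_inter] at hu hv
  rw [expect_monoInd_mul hc hu.1]
  gcongr
  -- Once `e` has the colour of `u`, the vertex `v` agrees with `u` for free, so `f` needs agreement
  -- only on `f \ {v}`; this saves one factor `c⁻¹`.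
  have huf : u ∈ f.erase v := mem_erase.2 ⟨huv, hu.2⟩
  have hcard : #f - 2 = #(f.erase v) - 1 := by rw [card_erase_of_mem hv.2]; omega
  rw [hcard, ← expect_monoInd hc ⟨u, huf⟩]
  refine expect_le_expect fun x _ => ?_
  by_cases h : IsConstOn x (f.erase v)
  · have : IsConstOn (recolor e u x) f := by
      have key : ∀ a ∈ f, recolor e u x a = x u := by
        intro a ha
        unfold recolor
        split_ifs with hae
        · rfl
        · refine h a (mem_erase.2 ⟨?_, ha⟩) u huf
          rintro rfl
          exact hae hv.1
      intro a ha b hb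
      rw [key a ha, key b hb]
    simp [monoInd, h, this]
  · simpa [monoInd, h] using monoInd_nonneg (recolor e u x) f

end Recolor

/-! ### Double counting of degrees and codegrees. -/

section Degrees

open Finset

lemma sum_sum_eq_sum_add_sum_offDiag {ι M : Type*} [DecidableEq ι] [AddCommMonoid M]
    (s : Finset ι) (F : ι → ι → M) :
    ∑ i ∈ s, ∑ j ∈ s, F i j = ∑ i ∈ s, F i i + ∑ q ∈ s.offDiag, F q.1 q.2 := by
  rw [← sum_product', ← diag_union_offDiag, sum_union (disjoint_diag_offDiag s), sum_diag]

variable {V : Type*} [DecidableEq V]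

/-- The number of members of `E` that contain `v`. -/
def vertexDegree (E : Finset (Finset V)) (v : V) : ℕ := #{e ∈ E | v ∈ e}

/-- The ordered pairs of distinct hyperedges that share at least two vertices. -/
def heavyPairs (E : Finset (Finset V)) : Finset (Finset V × Finset V) :=
  {q ∈ E.offDiag | 2 ≤ #(q.1 ∩ q.2)}

variable [Fintype V]

lemma sum_vertexDegree {E : Finset (Finset V)} {r : ℕ} (hE : ∀ e ∈ E, #e = r) :
    ∑ v, vertexDegree E v = #E * r := by
  simp only [vertexDegree, card_filter]
  rw [sum_comm, sum_congr rfl (g := fun _ => r), sum_const, smul_eq_mul]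
  intro e he
  simp [hE e he]

lemma sum_sq_codegree {E : Finset (Finset V)} :
    ∑ q : V × V, (#{e ∈ E | q ∈ e.offDiag}) ^ 2 = ∑ e ∈ E, ∑ f ∈ E, #(e ∩ f).offDiag := by
  simp only [card_filter, sq, sum_mul_sum]
  rw [sum_comm]
  refine sum_congr rfl fun e _ => ?_
  rw [sum_comm]
  refine sum_congr rfl fun f _ => ?_
  simp only [← ite_and, mul_ite, mul_one, mul_zero]
  rw [← card_filter]
  congr 1
  ext q
  simp only [mem_filter, mem_univ, true_and, mem_offDiag, mem_inter]
  tauto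

/-- The sum of squared codegrees counts ordered pairs of vertices common to two hyperedges: only
equal or heavy pairs contribute, each at most `r ^ 2`. -/
lemma sum_sq_codegree_le {E : Finset (Finset V)} {r : ℕ} (hE : ∀ e ∈ E, #e = r) :
    ∑ q : V × V, (#{e ∈ E | q ∈ e.offDiag}) ^ 2 ≤ r ^ 2 * (#E + #(heavyPairs E)) := by
  have hr : ∀ e ∈ E, ∀ f, #(e ∩ f).offDiag ≤ r ^ 2 := by
    intro e he f
    rw [offDiag_card, sq]
    have : #(e ∩ f) ≤ r := (card_le_card inter_subset_left).trans (hE e he).le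
    exact (Nat.sub_le _ _).trans (Nat.mul_le_mul this this)
  rw [sum_sq_codegree, sum_sum_eq_sum_add_sum_offDiag, mul_add]
  gcongr
  · calc _ ≤ ∑ _e ∈ E, r ^ 2 := sum_le_sum fun e he => hr e he e
      _ = _ := by simp [mul_comm]
  · calc _ ≤ ∑ q ∈ E.offDiag, if 2 ≤ #(q.1 ∩ q.2) then r ^ 2 else 0 := by
          refine sum_le_sum fun q hq => ?_
          split_ifs with h
          · exact hr _ (mem_offDiag.1 hq).1 _
          · rw [offDiag_card]
            have : #(q.1 ∩ q.2) = 0 ∨ #(q.1 ∩ q.2) = 1 := by omega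
            rcases this with h | h <;> simp [h]
      _ = _ := by rw [← sum_filter, sum_const, smul_eq_mul, mul_comm]; rfl

/-- If `u e` has the largest degree in `e`, then the other degrees in `e` are small on average. -/
lemma sum_sum_vertexDegree_erase_le {E : Finset (Finset V)} {r : ℕ} (hE : ∀ e ∈ E, #e = r)
    {u : Finset V → V} (hu : ∀ e ∈ E, u e ∈ e)
    (hmax : ∀ e ∈ E, ∀ v ∈ e, vertexDegree E v ≤ vertexDegree E (u e)) :
    ∑ e ∈ E, ∑ v ∈ e.erase (u e), (vertexDegree E v : ℝ) ≤
      (r ^ 2 * #E) * √((#E : ℝ) + #(heavyPairs E)) := by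
  set d : V → ℝ := fun v => (vertexDegree E v : ℝ) with hd
  have hd0 : ∀ v, 0 ≤ d v := fun v => Nat.cast_nonneg _
  -- Maximality gives `d v ≤ √(d (u e) * d v)`, a symmetric quantity that can be summed over all
  -- ordered pairs in `e`.
  have h1 : ∑ e ∈ E, ∑ v ∈ e.erase (u e), d v ≤
      ∑ q : V × V, (#{e ∈ E | q ∈ e.offDiag} : ℝ) * √(d q.1 * d q.2) := by
    calc _ ≤ ∑ e ∈ E, ∑ q ∈ e.offDiag, √(d q.1 * d q.2) := by
          refine sum_le_sum fun e he => ?_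
          calc _ ≤ ∑ v ∈ e.erase (u e), √(d (u e) * d v) := by
                refine sum_le_sum fun v hv => Real.le_sqrt_of_sq_le ?_
                rw [sq]
                refine mul_le_mul_of_nonneg_right ?_ (hd0 v)
                exact Nat.cast_le.2 (hmax e he v (mem_of_mem_erase hv))
            _ = ∑ q ∈ (e.erase (u e)).image fun v => (u e, v), √(d q.1 * d q.2) := by
                rw [sum_image]
                intro a _ b _ hab
                exact (Prod.mk.inj hab).2
            _ ≤ _ := by
                refine sum_le_sum_of_subset_of_nonneg ?_ fun _ _ _ => Real.sqrt_nonneg _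
                intro q hq
                obtain ⟨v, hv, rfl⟩ := mem_image.1 hq
                rw [mem_erase] at hv
                exact mem_offDiag.2 ⟨hu e he, hv.2, hv.1.symm⟩
      _ = _ := by
          simp only [card_filter, Nat.cast_sum, sum_mul]
          rw [sum_comm]
          refine sum_congr rfl fun e _ => ?_
          simp only [ite_mul, Nat.cast_ite, Nat.cast_one, Nat.cast_zero, one_mul, zero_mul]
          rw [← sum_filter]
          exact sum_congr (by ext q; simp) fun _ _ => rfl
  -- Cauchy–Schwarz separates codegrees from degrees; the degree factor is `(∑ d)² = (#E * r)²`.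
  have h2 : (∑ q : V × V, (#{e ∈ E | q ∈ e.offDiag} : ℝ) * √(d q.1 * d q.2)) ^ 2 ≤
      (r ^ 2 * ((#E : ℝ) + #(heavyPairs E))) * (#E * r) ^ 2 := by
    refine (sum_mul_sq_le_sq_mul_sq _ _ _).trans ?_
    gcongr
    · exact_mod_cast sum_sq_codegree_le hE
    · have : ∀ q : V × V, √(d q.1 * d q.2) ^ 2 = d q.1 * d q.2 := fun q =>
        Real.sq_sqrt (mul_nonneg (hd0 _) (hd0 _))
      simp only [this]
      rw [Fintype.sum_prod_type, ← Fintype.sum_mul_sum, ← sq]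
      gcongr
      simp only [hd]
      exact_mod_cast (sum_vertexDegree hE).le
  refine h1.trans ((Real.le_sqrt_of_sq_le h2).trans (le_of_eq ?_))
  rw [show (r ^ 2 * ((#E : ℝ) + #(heavyPairs E))) * (#E * r) ^ 2 =
    (r ^ 2 * #E) ^ 2 * ((#E : ℝ) + #(heavyPairs E)) by ring,
    Real.sqrt_mul (by positivity), Real.sqrt_sq (by positivity)]

end Degrees

/-! ### Effect of one recolouring, and the variance. -/

section Moments

open Finset

variable {V : Type*} {c : ℕ}

/-- The weighted number of monochromatic members of `E`. -/
def monoSum (E : Finset (Finset V)) (w : Finset V → ℕ) (x : V → Fin c) : ℝ :=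
  ∑ e ∈ E, (w e : ℝ) * monoInd x e

variable [DecidableEq V]

/-- Recolouring `e` creates exactly one monochromatic hyperedge, except on a rare event. -/
lemma monoSum_recolor (E : Finset (Finset V)) (w : Finset V → ℕ) {e : Finset V} (he : e ∈ E)
    (hw : 1 ≤ w e) (u : V) (x : V → Fin c) :
    1 ≤ (if 2 ≤ w e then 1 else 0) + monoInd x e +
        ∑ f ∈ E with f ≠ e ∧ ¬ Disjoint f (e.erase u),
          (monoInd x f + monoInd (recolor e u x) f) ∨
      monoSum E w (recolor e u x) = monoSum E w x + 1 := by
  set S := ∑ f ∈ E with f ≠ e ∧ ¬ Disjoint f (e.erase u),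
          (monoInd x f + monoInd (recolor e u x) f) with hS
  -- Indicators take values in `{0, 1}`, so an error total below 1 forces every term in it to
  -- vanish.
  have zero_of_lt : ∀ (y : V → Fin c) (f : Finset V), monoInd y f < 1 → monoInd y f = 0 := by
    intro y f
    unfold monoInd
    split_ifs <;> norm_num
  have hS0 : ∀ f ∈ E, f ≠ e ∧ ¬ Disjoint f (e.erase u) →
      monoInd x f + monoInd (recolor e u x) f ≤ S := fun f hf h =>
    single_le_sum (f := fun f => monoInd x f + monoInd (recolor e u x) f)
      (fun f _ => add_nonneg (monoInd_nonneg _ _) (monoInd_nonneg _ _)) (mem_filter.2 ⟨hf, h⟩)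
  have hSnn : 0 ≤ S :=
    sum_nonneg fun f _ => add_nonneg (monoInd_nonneg _ _) (monoInd_nonneg _ _)
  have hxe := monoInd_nonneg x e
  rw [or_iff_not_imp_left, not_le]
  intro hlt
  have hw1 : w e = 1 := by
    by_contra hne
    rw [if_pos (by omega)] at hlt
    linarith
  rw [if_neg (by omega)] at hlt
  have hx0 := zero_of_lt x e (by linarith)
  unfold monoSum
  rw [← add_sum_erase _ _ he, ← add_sum_erase _ _ he, hw1, monoInd_recolor, hx0]
  have : ∀ f ∈ E.erase e, (w f : ℝ) * monoInd (recolor e u x) f = w f * monoInd x f := by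
    intro f hf
    rw [mem_erase] at hf
    congr 1
    by_cases hd : Disjoint f (e.erase u)
    · exact monoInd_congr fun v hv =>
        recolor_of_notMem_erase x fun h => disjoint_left.1 hd hv h
    · have h1 := hS0 f hf.2 ⟨hf.1, hd⟩
      have h2 := monoInd_nonneg x f
      have h3 := monoInd_nonneg (recolor e u x) f
      rw [zero_of_lt x f (by linarith), zero_of_lt (recolor e u x) f (by linarith)]
  rw [sum_congr rfl this]
  simp [add_comm]

variable [Fintype V]

/-- The expected number of ordered pairs of distinct monochromatic hyperedges that share at least
two vertices. -/
noncomputable def heavyMass (c : ℕ) (E : Finset (Finset V)) : ℝ :=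
  ∑ q ∈ heavyPairs E, 𝔼 x : V → Fin c, monoInd x q.1 * monoInd x q.2

variable {E : Finset (Finset V)} {w : Finset V → ℕ} {r K : ℕ}

lemma expect_monoSum (hc : c ≠ 0) (hr : r ≠ 0) (hE : ∀ e ∈ E, #e = r) :
    𝔼 x : V → Fin c, monoSum E w x = (∑ e ∈ E, (w e : ℝ)) * (c : ℝ)⁻¹ ^ (r - 1) := by
  unfold monoSum
  rw [expect_sum_comm, sum_mul]
  refine sum_congr rfl fun e he => ?_
  rw [← mul_expect, expect_monoInd hc (card_pos.1 (by rw [hE e he]; omega)), hE e he]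

lemma sq_le_expect_of_mem_heavyPairs (hr : 2 ≤ r) (hc : 2 ≤ c) (hE : ∀ e ∈ E, #e = r)
    {q : Finset V × Finset V} (hq : q ∈ heavyPairs E) :
    2 * ((c : ℝ)⁻¹ ^ (r - 1)) ^ 2 ≤ 𝔼 x : V → Fin c, monoInd x q.1 * monoInd x q.2 := by
  rw [heavyPairs, mem_filter, mem_offDiag] at hq
  have h := le_expect_monoInd_mul_monoInd (c := c) (by omega) hq.2
  rw [hE _ hq.1.1, hE _ hq.1.2.1] at h
  refine le_trans ?_ h
  obtain ⟨k, rfl⟩ := Nat.exists_eq_add_of_le hr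
  have e1 : 2 + k - 1 = k + 1 := by omega
  have e2 : 2 + k - 2 = k := by omega
  rw [e1, e2]
  have hcinv : (c : ℝ)⁻¹ ≤ 2⁻¹ := inv_anti₀ (by norm_num) (by exact_mod_cast hc)
  have hc0 : (0 : ℝ) ≤ (c : ℝ)⁻¹ := by positivity
  rw [show 2 * ((c : ℝ)⁻¹ ^ (k + 1)) ^ 2 = (c : ℝ)⁻¹ ^ (k + 1) * (c : ℝ)⁻¹ ^ k * (2 * (c : ℝ)⁻¹) by
    ring]
  exact mul_le_of_le_one_right (by positivity) (by linarith)

/-- When the variance is close to the mean, hyperedges of weight at least two and pairs of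
hyperedges that share at least two vertices are rarely monochromatic. -/
lemma rare_events_le_variance_sub_mean (hr : 2 ≤ r) (hc : 2 ≤ c) (hE : ∀ e ∈ E, #e = r)
    (hw : ∀ e ∈ E, 1 ≤ w e ∧ w e ≤ K) :
    (c : ℝ)⁻¹ ^ (r - 1) * #{e ∈ E | 2 ≤ w e} + heavyMass c E / 2 ≤
      (𝔼 x : V → Fin c, monoSum E w x ^ 2) - (𝔼 x : V → Fin c, monoSum E w x) ^ 2
        - (𝔼 x : V → Fin c, monoSum E w x)
        + K * (c : ℝ)⁻¹ ^ (r - 1) * (𝔼 x : V → Fin c, monoSum E w x) := by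
  have hc0 : c ≠ 0 := by omega
  have hne : ∀ e ∈ E, e.Nonempty := fun e he => card_pos.1 (by rw [hE e he]; omega)
  rw [expect_monoSum hc0 (by omega) hE]
  set p := (c : ℝ)⁻¹ ^ (r - 1) with hp
  have hp0 : 0 ≤ p := by positivity
  set J : Finset V → Finset V → ℝ := fun e f => 𝔼 x : V → Fin c, monoInd x e * monoInd x f with hJ
  have hsq : (𝔼 x : V → Fin c, monoSum E w x ^ 2) = ∑ e ∈ E, ∑ f ∈ E, (w e : ℝ) * w f * J e f := by
    simp only [monoSum, sq, sum_mul_sum]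
    rw [expect_sum_comm]
    refine sum_congr rfl fun e _ => ?_
    rw [expect_sum_comm]
    refine sum_congr rfl fun f _ => ?_
    rw [hJ, mul_expect]
    exact expect_congr rfl fun x _ => by ring
  have hdiff : (𝔼 x : V → Fin c, monoSum E w x ^ 2) - ((∑ e ∈ E, (w e : ℝ)) * p) ^ 2 =
      ∑ e ∈ E, (w e : ℝ) * w e * (p - p ^ 2) +
        ∑ q ∈ E.offDiag, (w q.1 : ℝ) * w q.2 * (J q.1 q.2 - p ^ 2) := by
    have hdiag : ∀ e ∈ E, (w e : ℝ) * w e * (p - p ^ 2) = (w e : ℝ) * w e * (J e e - p ^ 2) := by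
      intro e he
      have : J e e = p := by
        simp only [hJ, monoInd_mul_self]
        rw [expect_monoInd hc0 (hne e he), hE e he]
      rw [this]
    rw [sum_congr rfl hdiag,
      ← sum_sum_eq_sum_add_sum_offDiag E fun e f => (w e : ℝ) * w f * (J e f - p ^ 2), hsq]
    simp only [mul_sub, sum_sub_distrib]
    congr 1
    rw [mul_pow, sq (∑ e ∈ E, (w e : ℝ)), sum_mul_sum, sum_mul]
    exact sum_congr rfl fun e _ => sum_mul _ _ _
  -- Light pairs have zero covariance; for heavy ones `J ≥ 2 * p ^ 2` gives `J - p ^ 2 ≥ J / 2`.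
  have hoff : heavyMass c E / 2 ≤
      ∑ q ∈ E.offDiag, (w q.1 : ℝ) * w q.2 * (J q.1 q.2 - p ^ 2) := by
    calc heavyMass c E / 2 = ∑ q ∈ E.offDiag, if 2 ≤ #(q.1 ∩ q.2) then J q.1 q.2 / 2 else 0 := by
          rw [← sum_filter, heavyMass, sum_div]; rfl
      _ ≤ _ := by
          refine sum_le_sum fun q hq => ?_
          have hq' := mem_offDiag.1 hq
          split_ifs with h
          · have hge := sq_le_expect_of_mem_heavyPairs hr hc hE (mem_filter.2 ⟨hq, h⟩)
            rw [← hp] at hge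
            have hge' : 2 * p ^ 2 ≤ J q.1 q.2 := hge
            have w1 : (1 : ℝ) ≤ w q.1 := by exact_mod_cast (hw _ hq'.1).1
            have w2 : (1 : ℝ) ≤ w q.2 := by exact_mod_cast (hw _ hq'.2.1).1
            have : J q.1 q.2 - p ^ 2 ≤ (w q.1 : ℝ) * w q.2 * (J q.1 q.2 - p ^ 2) :=
              le_mul_of_one_le_left (by nlinarith [sq_nonneg p]) (by nlinarith)
            linarith
          · have : J q.1 q.2 = p ^ 2 := by
              rw [hJ]
              simp only
              rw [expect_monoInd_mul_monoInd_of_card_inter_le hc0 (hne _ hq'.1) (hne _ hq'.2.1)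
                (by omega), hE _ hq'.1, hE _ hq'.2.1, sq]
            rw [this]; simp
  -- The summand on the right is `w (w - 1) p + (K - w) w p²`; the `K` term absorbs the loss `-w²
  -- p²`.
  have hdiag : p * #{e ∈ E | 2 ≤ w e} ≤
      ∑ e ∈ E, (w e : ℝ) * w e * (p - p ^ 2) - (∑ e ∈ E, (w e : ℝ)) * p +
        K * p * ((∑ e ∈ E, (w e : ℝ)) * p) := by
    rw [card_filter, sum_mul, mul_sum, Nat.cast_sum, mul_sum, ← sum_sub_distrib,
      ← sum_add_distrib]
    refine sum_le_sum fun e he => ?_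
    have w1 : (1 : ℝ) ≤ w e := by exact_mod_cast (hw _ he).1
    have wK : (w e : ℝ) ≤ K := by exact_mod_cast (hw _ he).2
    have hK : 0 ≤ ((K : ℝ) - w e) * w e * p ^ 2 :=
      mul_nonneg (mul_nonneg (by linarith) (by linarith)) (sq_nonneg p)
    split_ifs with h
    · have w2 : (2 : ℝ) ≤ w e := by exact_mod_cast h
      have : p ≤ ((w e : ℝ) * (w e - 1)) * p := le_mul_of_one_le_left hp0 (by nlinarith)
      push_cast
      nlinarith
    · have : 0 ≤ ((w e : ℝ) * (w e - 1)) * p := mul_nonneg (by nlinarith) hp0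
      push_cast
      nlinarith
  linarith

end Moments

/-! ### The approximate Stein–Chen identity. -/

section Stein

open Finset

variable {V : Type*} [DecidableEq V] {c : ℕ}
  {E : Finset (Finset V)} {w : Finset V → ℕ} {r K : ℕ}

lemma card_filter_not_disjoint_le (E : Finset (Finset V)) (s : Finset V) :
    #{f ∈ E | ¬ Disjoint f s} ≤ ∑ v ∈ s, vertexDegree E v := by
  have hsub : {f ∈ E | ¬ Disjoint f s} ⊆ s.biUnion fun v => {f ∈ E | v ∈ f} := by
    intro f hf
    rw [mem_filter, not_disjoint_iff] at hf
    obtain ⟨hfE, v, hvf, hvs⟩ := hf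
    exact mem_biUnion.2 ⟨v, hvs, mem_filter.2 ⟨hfE, hvf⟩⟩
  exact (card_le_card hsub).trans card_biUnion_le

variable [Fintype V]

/-- Total probability, over the hyperedges, of the event that recolouring is not harmless. -/
lemma sum_coupling_error_le (hr : 2 ≤ r) (hc : 2 ≤ c) (hE : ∀ e ∈ E, #e = r)
    {u : Finset V → V} (hu : ∀ e ∈ E, u e ∈ e)
    (hmax : ∀ e ∈ E, ∀ v ∈ e, vertexDegree E v ≤ vertexDegree E (u e)) :
    ∑ e ∈ E, (c : ℝ)⁻¹ ^ (r - 1) * 𝔼 x : V → Fin c, ((if 2 ≤ w e then 1 else 0) + monoInd x e +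
        ∑ f ∈ E with f ≠ e ∧ ¬ Disjoint f (e.erase (u e)),
          (monoInd x f + monoInd (recolor e (u e) x) f)) ≤
      (c : ℝ)⁻¹ ^ (r - 1) * #{e ∈ E | 2 ≤ w e} + #E * ((c : ℝ)⁻¹ ^ (r - 1)) ^ 2
        + 2 * heavyMass c E + 2 * ((c : ℝ)⁻¹ ^ (r - 1)) ^ 2 *
          ((r ^ 2 * #E) * √((#E : ℝ) + #(heavyPairs E))) := by
  have hc0 : c ≠ 0 := by omega
  have : NeZero c := ⟨hc0⟩
  have hne : ∀ e ∈ E, e.Nonempty := fun e he => ⟨u e, hu e he⟩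
  set p := (c : ℝ)⁻¹ ^ (r - 1) with hp
  have hp0 : 0 ≤ p := by positivity
  have hI : ∀ e ∈ E, 𝔼 x : V → Fin c, monoInd x e = p := fun e he => by
    rw [expect_monoInd hc0 (hne e he), hE e he]
  set J : Finset V → Finset V → ℝ := fun e f => 𝔼 x : V → Fin c, monoInd x e * monoInd x f with hJ
  have hterm : ∀ e ∈ E, p * 𝔼 x : V → Fin c, ((if 2 ≤ w e then 1 else 0) + monoInd x e +
        ∑ f ∈ E with f ≠ e ∧ ¬ Disjoint f (e.erase (u e)),
          (monoInd x f + monoInd (recolor e (u e) x) f)) =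
      p * (if 2 ≤ w e then 1 else 0) + p ^ 2 +
        ∑ f ∈ E with f ≠ e ∧ ¬ Disjoint f (e.erase (u e)), (p ^ 2 + J e f) := by
    intro e he
    rw [expect_add_distrib, expect_add_distrib, Fintype.expect_const, hI e he, expect_sum_comm,
      mul_add, mul_add, mul_sum, sq]
    congr 1
    refine sum_congr rfl fun f hf => ?_
    have hf := (mem_filter.1 hf).1
    rw [expect_add_distrib, mul_add, hI f hf, hJ]
    congr 1
    simp only
    rw [expect_monoInd_mul hc0 (hu e he), hE e he]
  -- A heavy `f` costs `p ^ 2 + J ≤ 2 * J`, a light one exactly `2 * p ^ 2`; the number of relevant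
  -- `f` is at most the sum of degrees over `e \ {u e}`.
  have hinner : ∀ e ∈ E,
      ∑ f ∈ E with f ≠ e ∧ ¬ Disjoint f (e.erase (u e)), (p ^ 2 + J e f) ≤
        ∑ f ∈ E, (if e ≠ f ∧ 2 ≤ #(e ∩ f) then 2 * J e f else 0) +
          2 * p ^ 2 * ∑ v ∈ e.erase (u e), (vertexDegree E v : ℝ) := by
    intro e he
    have hJ0 : ∀ f, 0 ≤ J e f := fun f =>
      expect_nonneg fun x _ => mul_nonneg (monoInd_nonneg _ _) (monoInd_nonneg _ _)
    calc _ ≤ ∑ f ∈ E with f ≠ e ∧ ¬ Disjoint f (e.erase (u e)),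
            ((if e ≠ f ∧ 2 ≤ #(e ∩ f) then 2 * J e f else 0) + 2 * p ^ 2) := by
          refine sum_le_sum fun f hf => ?_
          rw [mem_filter] at hf
          split_ifs with h
          · have hge := sq_le_expect_of_mem_heavyPairs hr hc hE (q := (e, f))
              (mem_filter.2 ⟨mem_offDiag.2 ⟨he, hf.1, h.1⟩, h.2⟩)
            rw [← hp] at hge
            have hge' : 2 * p ^ 2 ≤ J e f := hge
            nlinarith [sq_nonneg p]
          · have : J e f = p ^ 2 := by
              rw [hJ]
              simp only
              have hle : ¬ 2 ≤ #(e ∩ f) := fun h2 => h ⟨hf.2.1.symm, h2⟩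
              rw [expect_monoInd_mul_monoInd_of_card_inter_le hc0 (hne _ he) (hne _ hf.1)
                (by omega), hE _ he, hE _ hf.1, sq]
            linarith
      _ ≤ _ := by
          rw [sum_add_distrib]
          refine add_le_add ?_ ?_
          · refine sum_le_sum_of_subset_of_nonneg (filter_subset _ _) fun f _ _ => ?_
            split_ifs
            · linarith [hJ0 f]
            · exact le_rfl
          · rw [sum_const, nsmul_eq_mul, mul_comm]
            refine mul_le_mul_of_nonneg_left ?_ (by positivity)
            have h1 : #{f ∈ E | f ≠ e ∧ ¬ Disjoint f (e.erase (u e))} ≤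
                #{f ∈ E | ¬ Disjoint f (e.erase (u e))} :=
              card_le_card (monotone_filter_right _ fun f _ h => h.2)
            exact_mod_cast h1.trans (card_filter_not_disjoint_le _ _)
  have hheavy : ∑ e ∈ E, ∑ f ∈ E, (if e ≠ f ∧ 2 ≤ #(e ∩ f) then 2 * J e f else 0) =
      2 * heavyMass c E := by
    rw [sum_sum_eq_sum_add_sum_offDiag, heavyMass, heavyPairs, sum_filter, mul_sum]
    simp only [ne_eq, not_true_eq_false, false_and, if_false, sum_const_zero, zero_add]
    refine sum_congr rfl fun q hq => ?_
    simp [(mem_offDiag.1 hq).2.2, hJ]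
  rw [sum_congr rfl hterm, sum_add_distrib, sum_add_distrib, sum_const, nsmul_eq_mul, ← mul_sum,
    card_filter, Nat.cast_sum]
  have h2 := sum_le_sum hinner
  rw [sum_add_distrib, hheavy, ← mul_sum] at h2
  have h3 := mul_le_mul_of_nonneg_left (sum_sum_vertexDegree_erase_le hE hu hmax)
    (show 0 ≤ 2 * p ^ 2 by positivity)
  push_cast
  linarith

/-- Pointwise `‖g - h‖ ≤ 2 * T`: where `g ≠ h`, the trivial bound 2 suffices because `T ≥ 1`. -/
lemma norm_expect_sub_le_of_coupling {ι : Type*} [Fintype ι] {g h : ι → ℂ} {T : ι → ℝ}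
    (hg : ∀ i, ‖g i‖ ≤ 1) (hh : ∀ i, ‖h i‖ ≤ 1) (hT : ∀ i, 0 ≤ T i)
    (H : ∀ i, 1 ≤ T i ∨ g i = h i) :
    ‖𝔼 i, g i - 𝔼 i, h i‖ ≤ 2 * 𝔼 i, T i := by
  rw [← expect_sub_distrib, mul_expect]
  refine (RCLike.norm_expect_le (K := ℂ)).trans (expect_le_expect fun i _ => ?_)
  rcases H i with h1 | h1
  · linarith [norm_sub_le (g i) (h i), hg i, hh i]
  · simp [h1, hT i]

/-- Approximate size-bias (Stein–Chen) identity for the exponential test functions. -/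
lemma norm_expect_monoSum_smul_exp_sub_le (hr : 2 ≤ r) (hc : 2 ≤ c) (hE : ∀ e ∈ E, #e = r)
    (hw : ∀ e ∈ E, 1 ≤ w e ∧ w e ≤ K) (θ : ℝ) {μ δ : ℝ}
    (hμ : μ = 𝔼 x : V → Fin c, monoSum E w x)
    (hδ : δ = (𝔼 x : V → Fin c, monoSum E w x ^ 2) - μ ^ 2 - μ + K * (c : ℝ)⁻¹ ^ (r - 1) * μ) :
    ‖𝔼 x : V → Fin c, monoSum E w x • Complex.exp ((θ * monoSum E w x : ℝ) * Complex.I) -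
        μ • (Complex.exp (θ * Complex.I) *
          𝔼 x : V → Fin c, Complex.exp ((θ * monoSum E w x : ℝ) * Complex.I))‖ ≤
      2 * K * ((c : ℝ)⁻¹ ^ (r - 1) * μ + 5 * δ +
        2 * r ^ 2 * μ * √((c : ℝ)⁻¹ ^ (r - 1) * μ + 2 * δ)) := by
  have hc0 : c ≠ 0 := by omega
  have : NeZero c := ⟨hc0⟩
  have hne : ∀ e ∈ E, e.Nonempty := fun e he => card_pos.1 (by rw [hE e he]; omega)
  have hrare := rare_events_le_variance_sub_mean hr hc hE hw
  rw [← hμ, ← hδ] at hrare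
  rw [expect_monoSum hc0 (by omega) hE] at hμ
  rcases E.eq_empty_or_nonempty with rfl | ⟨e₀, he₀⟩
  · have hμ0 : μ = 0 := by simpa using hμ
    have hδ0 : δ = 0 := by simpa [monoSum, hμ0] using hδ
    simp [monoSum, hμ0, hδ0]
  have : Nonempty V := ⟨(hne e₀ he₀).choose⟩
  have hexu : ∀ e ∈ E, ∃ u ∈ e, ∀ v ∈ e, vertexDegree E v ≤ vertexDegree E u := fun e he =>
    exists_max_image e (vertexDegree E) (hne e he)
  choose! u hu using hexu
  have hcoup := sum_coupling_error_le (w := w) hr hc hE (fun e he => (hu e he).1)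
    (fun e he => (hu e he).2)
  set p := (c : ℝ)⁻¹ ^ (r - 1) with hp
  have hp0 : 0 ≤ p := by positivity
  set T : Finset V → (V → Fin c) → ℝ := fun e x => (if 2 ≤ w e then 1 else 0) + monoInd x e +
        ∑ f ∈ E with f ≠ e ∧ ¬ Disjoint f (e.erase (u e)),
          (monoInd x f + monoInd (recolor e (u e) x) f) with hTdef
  have hT0 : ∀ e x, 0 ≤ T e x := by
    intro e x
    refine add_nonneg (add_nonneg (by split_ifs <;> norm_num) (monoInd_nonneg _ _)) ?_
    exact sum_nonneg fun f _ => add_nonneg (monoInd_nonneg _ _) (monoInd_nonneg _ _)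
  have hTE0 : ∀ e, 0 ≤ p * 𝔼 x, T e x := fun e =>
    mul_nonneg hp0 (expect_nonneg fun x _ => hT0 e x)
  set g : ℝ → ℂ := fun y => Complex.exp ((θ * y : ℝ) * Complex.I) with hg
  have hg1 : ∀ y, ‖g y‖ = 1 := fun y => Complex.norm_exp_ofReal_mul_I _
  have hgadd : ∀ y, g (y + 1) = Complex.exp (θ * Complex.I) * g y := by
    intro y
    rw [hg]
    simp only
    rw [← Complex.exp_add]
    congr 1
    push_cast; ring
  have hsum : 𝔼 x : V → Fin c, monoSum E w x • g (monoSum E w x) =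
      ∑ e ∈ E, ((w e : ℝ) * p) • 𝔼 x : V → Fin c, g (monoSum E w (recolor e (u e) x)) := by
    have : ∀ x : V → Fin c, monoSum E w x • g (monoSum E w x) =
        ∑ e ∈ E, (w e : ℝ) • monoInd x e • g (monoSum E w x) := by
      intro x
      conv_lhs => enter [1]; unfold monoSum
      rw [sum_smul]
      exact sum_congr rfl fun e _ => mul_smul _ _ _
    simp only [this]
    rw [expect_sum_comm]
    refine sum_congr rfl fun e he => ?_
    rw [← smul_expect, expect_monoInd_smul hc0 (hu e he).1, hE e he, mul_smul]
  have hdiff : ‖𝔼 x : V → Fin c, monoSum E w x • g (monoSum E w x) -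
        μ • (Complex.exp (θ * Complex.I) * 𝔼 x : V → Fin c, g (monoSum E w x))‖ ≤
      ∑ e ∈ E, 2 * K * (p * 𝔼 x, T e x) := by
    rw [hsum, hμ, sum_mul, sum_smul, ← sum_sub_distrib]
    refine (norm_sum_le _ _).trans (sum_le_sum fun e he => ?_)
    rw [← smul_sub, norm_smul, mul_expect]
    have hwK : (w e : ℝ) ≤ K := by exact_mod_cast (hw e he).2
    have hn := norm_expect_sub_le_of_coupling
      (g := fun x : V → Fin c => g (monoSum E w (recolor e (u e) x)))
      (h := fun x : V → Fin c => Complex.exp (θ * Complex.I) * g (monoSum E w x)) (T := T e)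
      (fun x => (hg1 _).le)
      (fun x => by rw [norm_mul, hg1, Complex.norm_exp_ofReal_mul_I, one_mul]) (hT0 e)
      (fun x => by
        rcases monoSum_recolor E w he (hw e he).1 (u e) x with h | h
        · exact Or.inl h
        · exact Or.inr (by simp only [h, hgadd]))
    rw [Real.norm_of_nonneg (by positivity)]
    calc _ ≤ ((w e : ℝ) * p) * (2 * 𝔼 x, T e x) := by gcongr
      _ = w e * (2 * (p * 𝔼 x, T e x)) := by ring
      _ ≤ K * (2 * (p * 𝔼 x, T e x)) := by
          have := hTE0 e
          gcongr
      _ = _ := by ring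
  refine hdiff.trans ?_
  rw [← mul_sum]
  refine mul_le_mul_of_nonneg_left (hcoup.trans ?_) (by positivity)
  have hm : #E * p ≤ μ := by
    rw [hμ]
    gcongr
    rw [card_eq_sum_ones, Nat.cast_sum]
    exact sum_le_sum fun e he => by exact_mod_cast (hw e he).1
  have hm0 : 0 ≤ #E * p := by positivity
  have hB0 : 0 ≤ p * #{e ∈ E | 2 ≤ w e} := by positivity
  -- Each heavy pair has mass at least `p ^ 2`, so their number is controlled by `heavyMass`, hence
  -- by `2 * δ`.
  have hheavy : p ^ 2 * #(heavyPairs E) ≤ heavyMass c E := by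
    rw [heavyMass, mul_comm, ← nsmul_eq_mul, ← sum_const]
    refine sum_le_sum fun q hq => ?_
    have := sq_le_expect_of_mem_heavyPairs hr hc hE hq
    rw [← hp] at this
    linarith [sq_nonneg p]
  have hD0 : 0 ≤ heavyMass c E := le_trans (by positivity) hheavy
  have hsqrt : p * √((#E : ℝ) + #(heavyPairs E)) ≤ √(p * μ + 2 * δ) := by
    refine Real.le_sqrt_of_sq_le ?_
    rw [mul_pow, Real.sq_sqrt (by positivity)]
    nlinarith
  have hμ0 : 0 ≤ μ := hm0.trans hm
  have hlast : 2 * p ^ 2 * ((r ^ 2 * #E) * √((#E : ℝ) + #(heavyPairs E))) ≤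
      2 * r ^ 2 * μ * √(p * μ + 2 * δ) := by
    calc _ = 2 * r ^ 2 * (#E * p) * (p * √((#E : ℝ) + #(heavyPairs E))) := by ring
      _ ≤ _ := by gcongr
  -- The constant 5: the large-weight term is at most `δ`, and `2 * heavyMass` at most `4 * δ`.
  have : #E * p ^ 2 ≤ p * μ := by nlinarith
  linarith

end Stein

/-! ### The Poisson differential equation. -/

section CharFun

open Complex

/-- An approximate solution of the differential equation that characterises the characteristic
function of the Poisson distribution is close to that function. -/
lemma norm_mul_exp_sub_one_le {φ φ' : ℝ → ℂ} (hφ : ∀ θ, HasDerivAt φ (φ' θ) θ) (h0 : φ 0 = 1)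
    {lam ε : ℝ} (hlam : 0 ≤ lam)
    (h : ∀ θ : ℝ, ‖φ' θ - lam * I * cexp (θ * I) * φ θ‖ ≤ ε) (t : ℝ) :
    ‖φ t * cexp (-(lam * (cexp (t * I) - 1))) - 1‖ ≤ Real.exp (2 * lam) * ε * |t| := by
  set F : ℝ → ℂ := fun θ => φ θ * cexp (-(lam * (cexp (θ * I) - 1))) with hF
  have hlin : ∀ θ : ℝ, HasDerivAt (fun θ : ℝ => (θ : ℂ) * I) I θ := by
    intro θ
    simpa using (ofRealCLM.hasDerivAt (x := θ)).mul_const I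
  -- The integrating factor makes `F' = 0` for an exact solution; here `F'` is the factor times the
  -- defect.
  have hderiv : ∀ θ : ℝ, HasDerivAt F
      (cexp (-(lam * (cexp (θ * I) - 1))) * (φ' θ - lam * I * cexp (θ * I) * φ θ)) θ := by
    intro θ
    have h1 : HasDerivAt (fun θ : ℝ => cexp (-(lam * (cexp (θ * I) - 1))))
        (cexp (-(lam * (cexp (θ * I) - 1))) * -(lam * (cexp (θ * I) * I))) θ :=
      ((((hlin θ).cexp.sub_const 1).const_mul (lam : ℂ)).fun_neg).cexp
    exact ((hφ θ).mul h1).congr_deriv (by ring)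
  have hbound : ∀ θ ∈ (Set.univ : Set ℝ),
      ‖cexp (-(lam * (cexp (θ * I) - 1))) * (φ' θ - lam * I * cexp (θ * I) * φ θ)‖ ≤
        Real.exp (2 * lam) * ε := by
    intro θ _
    rw [norm_mul]
    have h1 : ‖cexp (-(lam * (cexp (θ * I) - 1)))‖ ≤ Real.exp (2 * lam) := by
      rw [norm_exp]
      refine Real.exp_le_exp.2 ((re_le_norm _).trans ?_)
      rw [norm_neg, norm_mul, norm_real, Real.norm_of_nonneg hlam, mul_comm]
      refine mul_le_mul_of_nonneg_right ((norm_sub_le _ _).trans ?_) hlam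
      rw [norm_exp_ofReal_mul_I, norm_one]
      norm_num
    exact mul_le_mul h1 (h θ) (norm_nonneg _) (Real.exp_pos _).le
  have := convex_univ.norm_image_sub_le_of_norm_hasDerivWithin_le
    (fun θ _ => (hderiv θ).hasDerivWithinAt) hbound (Set.mem_univ 0) (Set.mem_univ t)
  simpa [hF, h0] using this

lemma hasDerivAt_expect_exp {ι : Type*} [Fintype ι] (W : ι → ℝ) (θ : ℝ) :
    HasDerivAt (fun θ : ℝ => 𝔼 i, cexp ((θ * W i : ℝ) * I))
      ((𝔼 i, W i • cexp ((θ * W i : ℝ) * I)) * I) θ := by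
  have h : ∀ i, HasDerivAt (fun θ : ℝ => cexp ((θ * W i : ℝ) * I))
      (W i • cexp ((θ * W i : ℝ) * I) * I) θ := by
    intro i
    have h1 : HasDerivAt (fun θ : ℝ => ((θ * W i : ℝ) : ℂ) * I) (W i * I) θ := by
      have := ((hasDerivAt_id θ).mul_const (W i)).ofReal_comp.mul_const I
      simpa using this
    convert h1.cexp using 1
    rw [real_smul]; ring
  simp only [Fintype.expect_eq_sum_div_card, div_mul_eq_mul_div, Finset.sum_mul]
  exact (HasDerivAt.fun_sum fun i _ => h i).div_const _

end CharFun

/-! ### From hypergraphs and random colours to averages over colourings. -/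

section Transfer

variable {α : Type*} {H : Hypergraph α} {c : ℕ}

open Classical in
/-- The hyperedges of `H` as finite sets of vertices. -/
noncomputable def edgeFinsets (H : Hypergraph α) [Fintype V(H)] : Finset (Finset V(H)) :=
  {s | Subtype.val '' (s : Set V(H)) ∈ E(H)}

lemma mem_edgeFinsets [Fintype V(H)] {s : Finset V(H)} :
    s ∈ edgeFinsets H ↔ Subtype.val '' (s : Set V(H)) ∈ E(H) := by
  simp [edgeFinsets]

lemma weightedMonoCount_eq_monoSum [Fintype V(H)] (w : Set α → ℕ) (x : V(H) → Fin c) :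
    weightedMonoCount H w x =
      monoSum (edgeFinsets H) (fun s => w (Subtype.val '' (s : Set V(H)))) x := by
  have himg : E(H) = (fun s : Finset V(H) => Subtype.val '' (s : Set V(H))) '' edgeFinsets H := by
    ext e
    simp only [Set.mem_image, Finset.mem_coe, mem_edgeFinsets]
    constructor
    · intro he
      have hfin : (Subtype.val ⁻¹' e : Set V(H)).Finite := Set.toFinite _
      have hval : Subtype.val '' (hfin.toFinset : Set V(H)) = e := by
        rw [hfin.coe_toFinset, Subtype.image_preimage_coe]
        exact Set.inter_eq_right.2 (H.subset_vertexSet_of_mem_edgeSet' he)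
      exact ⟨hfin.toFinset, by rwa [hval], hval⟩
    · rintro ⟨s, hs, rfl⟩
      exact hs
  have hinj : Function.Injective fun s : Finset V(H) => Subtype.val '' (s : Set V(H)) :=
    (Set.image_injective.2 Subtype.val_injective).comp Finset.coe_injective
  unfold weightedMonoCount monoSum
  rw [himg, finsum_mem_image hinj.injOn, finsum_mem_coe_finset]
  refine Finset.sum_congr rfl fun s _ => ?_
  congr 1
  have : IsMonochromatic x (Subtype.val '' (s : Set V(H))) ↔ IsConstOn x s := by
    unfold IsMonochromatic IsConstOn
    simp only [Set.mem_image, Finset.mem_coe, Subtype.val_inj, exists_eq_right]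
    exact ⟨fun h u hu v hv => h u v hu hv, fun h u v hu hv => h u hu v hv⟩
  simp [monoInd, this]

variable {V Ω : Type*} [MeasurableSpace Ω] {P : Measure Ω} {X : V → Ω → Fin c}

lemma IsUniformColoring.aemeasurable [Countable V] (hX : IsUniformColoring X P) :
    AEMeasurable (fun ω v => X v ω) P :=
  aemeasurable_pi_lambda _ fun v => (hX.law v).aemeasurable

variable [Fintype V] [DecidableEq V] [IsProbabilityMeasure P]

lemma IsUniformColoring.integral_eq {𝕜 : Type*} [RCLike 𝕜] (hX : IsUniformColoring X P)
    (F : (V → Fin c) → 𝕜) :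
    ∫ ω, F (fun v => X v ω) ∂P = 𝔼 x, F x := by
  have hmap : P.map (fun ω v => X v ω) =
      Measure.pi fun _ : V => uniformOn (Set.univ : Set (Fin c)) := by
    rw [(iIndepFun_iff_map_fun_eq_pi_map fun v => (hX.law v).aemeasurable).1 hX.indep]
    congr 1
    funext v
    exact (hX.law v).map_eq
  have := Measure.isProbabilityMeasure_map hX.aemeasurable
  have hsingle : ∀ x, (P.map fun ω v => X v ω).real {x} = ((c : ℝ) ^ Fintype.card V)⁻¹ := by
    intro x
    -- `c ≠ 0` is not assumed: the law of `X v` already makes the uniform measure a probability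
    -- measure.
    have hσ : ∀ v : V, SigmaFinite (uniformOn (Set.univ : Set (Fin c))) := by
      intro v
      have := Measure.isProbabilityMeasure_map (hX.law v).aemeasurable
      rw [← (hX.law v).map_eq]
      infer_instance
    rw [hmap, Measure.real, ← Set.univ_pi_singleton, Measure.pi_pi]
    simp [uniformOn_univ]
  rw [← integral_map (f := F) hX.aemeasurable .of_discrete, integral_fintype .of_finite]
  simp only [hsingle]
  rw [← Finset.smul_sum, Fintype.expect_eq_sum_div_card, RCLike.real_smul_eq_coe_mul,
    div_eq_inv_mul]
  simp

lemma IsUniformColoring.variance_eq (hX : IsUniformColoring X P) (F : (V → Fin c) → ℝ) :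
    variance (fun ω => F (fun v => X v ω)) P = (𝔼 x, F x ^ 2) - (𝔼 x, F x) ^ 2 := by
  have := Measure.isProbabilityMeasure_map hX.aemeasurable
  have hmem : MemLp (F ∘ fun ω v => X v ω) 2 P :=
    MemLp.comp_of_map (μ := P) (f := fun ω v => X v ω) .of_discrete hX.aemeasurable
  have h := variance_eq_sub hmem
  rw [← hX.integral_eq F, ← hX.integral_eq fun x => F x ^ 2]
  exact h

lemma IsUniformColoring.charFun_eq (hX : IsUniformColoring X P) (F : (V → Fin c) → ℝ) (t : ℝ) :
    charFun (P.map fun ω => F (fun v => X v ω)) t =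
      𝔼 x, Complex.exp ((t * F x : ℝ) * Complex.I) := by
  have hF : AEMeasurable (fun ω => F (fun v => X v ω)) P :=
    (measurable_of_finite F).comp_aemeasurable hX.aemeasurable
  rw [charFun_apply_real, integral_map hF (by fun_prop), ← hX.integral_eq]
  simp

end Transfer

/-! ### Quantitative bound and passage to the limit. -/

section Limit

/-- Quantitative Poisson approximation for the characteristic function. -/
lemma norm_charFun_mul_exp_sub_one_le {α : Type*} {H : Hypergraph α} {r K c : ℕ} (hr : 2 ≤ r)
    (hc : 2 ≤ c) (hfin : V(H).Finite) (hunif : IsUniformHypergraph H r) {w : Set α → ℕ}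
    (hw : ∀ e ∈ E(H), 1 ≤ w e ∧ w e ≤ K) {Ω : Type*} [MeasurableSpace Ω] {P : Measure Ω}
    [IsProbabilityMeasure P] {X : V(H) → Ω → Fin c} (hX : IsUniformColoring X P)
    {lam μ v δ : ℝ} (hlam : 0 ≤ lam)
    (hμ : μ = ∫ ω, weightedMonoCount H w (fun v => X v ω) ∂P)
    (hv : v = variance (fun ω => weightedMonoCount H w (fun v => X v ω)) P)
    (hδ : δ = v - μ + K * (c : ℝ)⁻¹ ^ (r - 1) * μ) (t : ℝ) :
    ‖charFun (P.map fun ω => weightedMonoCount H w (fun v => X v ω)) t *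
        Complex.exp (-(lam * (Complex.exp (t * Complex.I) - 1))) - 1‖ ≤
      Real.exp (2 * lam) * (2 * K * ((c : ℝ)⁻¹ ^ (r - 1) * μ + 5 * δ +
        2 * r ^ 2 * μ * √((c : ℝ)⁻¹ ^ (r - 1) * μ + 2 * δ)) + |μ - lam|) * |t| := by
  classical
  have : Fintype V(H) := hfin.fintype
  have : NeZero c := ⟨by omega⟩
  simp only [weightedMonoCount_eq_monoSum] at hμ hv ⊢
  set E := edgeFinsets H with hEdef
  set w' : Finset V(H) → ℕ := fun s => w (Subtype.val '' (s : Set V(H))) with hw'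
  have hE : ∀ e ∈ E, e.card = r := by
    intro e he
    have h := hunif _ (mem_edgeFinsets.1 he)
    rw [Subtype.val_injective.encard_image, Set.encard_coe_eq_coe_finsetCard] at h
    exact_mod_cast h
  rw [hX.integral_eq fun x => monoSum E w' x] at hμ
  rw [hX.variance_eq fun x => monoSum E w' x, ← hμ] at hv
  rw [hv] at hδ
  rw [hX.charFun_eq fun x => monoSum E w' x]
  refine norm_mul_exp_sub_one_le (hasDerivAt_expect_exp fun x => monoSum E w' x)
    (by simp) hlam (fun θ => ?_) t
  have h := norm_expect_monoSum_smul_exp_sub_le (K := K) hr hc hE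
    (fun e he => hw _ (mem_edgeFinsets.1 he)) θ hμ hδ
  set φ := 𝔼 x : V(H) → Fin c, Complex.exp ((θ * monoSum E w' x : ℝ) * Complex.I) with hφ
  set ψ := 𝔼 x : V(H) → Fin c,
    monoSum E w' x • Complex.exp ((θ * monoSum E w' x : ℝ) * Complex.I) with hψ
  have hφ1 : ‖φ‖ ≤ 1 := by
    refine (RCLike.norm_expect_le (K := ℂ)).trans ?_
    simp only [Complex.norm_exp_ofReal_mul_I]
    simp
  -- The Stein identity involves the actual mean `μ`; replacing it by `lam` costs `|μ - lam|`.
  have hsplit : ψ * Complex.I - lam * Complex.I * Complex.exp (θ * Complex.I) * φ =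
      Complex.I * (ψ - μ • (Complex.exp (θ * Complex.I) * φ)) +
        ((μ - lam : ℝ) : ℂ) * (Complex.I * Complex.exp (θ * Complex.I) * φ) := by
    rw [Complex.real_smul]
    push_cast
    ring
  rw [hsplit]
  refine (norm_add_le _ _).trans (add_le_add ?_ ?_)
  · rw [norm_mul, Complex.norm_I, one_mul]
    exact h
  · rw [norm_mul, norm_mul, norm_mul, Complex.norm_I, Complex.norm_exp_ofReal_mul_I,
      Complex.norm_real, Real.norm_eq_abs, one_mul, one_mul]
    exact mul_le_of_le_one_right (abs_nonneg _) hφ1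

end Limit

end MonoColoring

theorem corollary1p12 (r K : ℕ) (hr : 2 ≤ r) (hK : 1 ≤ K)
    {α : ℕ → Type*} (H : (n : ℕ) → Hypergraph (α n))
    (hfin : ∀ n, V(H n).Finite)
    (hunif : ∀ n, MonoColoring.IsUniformHypergraph (H n) r)
    (w : (n : ℕ) → Set (α n) → ℕ)
    (hw : ∀ n, ∀ e ∈ E(H n), 1 ≤ w n e ∧ w n e ≤ K)
    (c : ℕ → ℕ) (hc : Tendsto c atTop atTop)
    {Ω : ℕ → Type*} [∀ n, MeasurableSpace (Ω n)]
    (P : (n : ℕ) → Measure (Ω n)) [∀ n, IsProbabilityMeasure (P n)]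
    (X : (n : ℕ) → V(H n) → Ω n → Fin (c n))
    (hX : ∀ n, MonoColoring.IsUniformColoring (X n) (P n))
    (lam : ℝ≥0)
    (hmean : Tendsto
      (fun n => ∫ ω, MonoColoring.weightedMonoCount (H n) (w n) (fun v => X n v ω) ∂(P n))
      atTop (𝓝 (lam : ℝ)))
    (hvar : Tendsto
      (fun n => variance
        (fun ω => MonoColoring.weightedMonoCount (H n) (w n) (fun v => X n v ω)) (P n))
      atTop (𝓝 (lam : ℝ))) :
    TendstoInDistribution
      (fun n ω => MonoColoring.weightedMonoCount (H n) (w n) (fun v => X n v ω))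
      atTop (fun k : ℕ => (k : ℝ)) P (poissonMeasure lam) := by
  have hmeas : ∀ n, AEMeasurable
      (fun ω => MonoColoring.weightedMonoCount (H n) (w n) (fun v => X n v ω)) (P n) := by
    intro n
    have : Fintype V(H n) := (hfin n).fintype
    exact (measurable_of_finite fun x : V(H n) → Fin (c n) =>
      MonoColoring.weightedMonoCount (H n) (w n) x).comp_aemeasurable (hX n).aemeasurable
  refine ⟨hmeas, .of_discrete, ?_⟩
  refine ProbabilityMeasure.tendsto_iff_tendsto_charFun.2 fun t => ?_
  simp only [ProbabilityMeasure.coe_mk]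
  rw [charFun_map_cast_poissonMeasure]
  have hp : Tendsto (fun n => (c n : ℝ)⁻¹ ^ (r - 1)) atTop (𝓝 0) := by
    have h := (tendsto_inv_atTop_zero.comp (tendsto_natCast_atTop_atTop.comp hc)).pow (r - 1)
      (M := ℝ)
    rw [zero_pow (by omega)] at h
    exact h
  -- Equality of the two limits enters here: `δ` tends to `lam - lam + 0 = 0`.
  have hδ := (hvar.sub hmean).add ((hp.const_mul (K : ℝ)).mul hmean)
  have hbound := ((((((hp.mul hmean).add (hδ.const_mul 5)).add
    ((hmean.const_mul (2 * (r : ℝ) ^ 2)).mul ((hp.mul hmean).add (hδ.const_mul 2)).sqrt)).const_mul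
      (2 * (K : ℝ))).add (hmean.sub_const (lam : ℝ)).abs).const_mul
        (Real.exp (2 * lam))).mul_const |t|
  simp only [sub_self, mul_zero, zero_mul, add_zero, Real.sqrt_zero, abs_zero] at hbound
  have hlim := squeeze_zero_norm' ((hc.eventually_ge_atTop 2).mono fun n hn =>
    MonoColoring.norm_charFun_mul_exp_sub_one_le hr hn (hfin n) (hunif n) (hw n) (hX n)
      lam.coe_nonneg rfl rfl rfl t) hbound
  -- Multiplying back by the Poisson characteristic function undoes the normalisation.
  have hprod := (hlim.add_const 1).mul_const
    (Complex.exp ((lam : ℝ) * (Complex.exp (t * Complex.I) - 1)))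
  simp only [sub_add_cancel, zero_add, one_mul, mul_assoc, ← Complex.exp_add, neg_add_cancel,
    Complex.exp_zero, mul_one] at hprod
  exact hprod
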